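/- Let $\Omega$ be a complete separable metric space with its Borel $\sigma$-algebra, and let $\mathcal H=C_{b.\mathrm{Lip}}(\Omega)$ be the space of bounded Lipschitz functions $\Omega\to\mathbb R$. Let $\hat{\mathbb E}:\mathcal H\to\mathbb R$ be a regular sublinear expectation: it is monotone, preserves constants, is subadditive and positively homogeneous, and $\hat{\mathbb E}[f_k]\downarrow 0$ whenever $f_k\in\mathcal H$ and $f_k\downarrow 0$ pointwise. Let $\mathcal P$ be the convex, weakly compact set of Borel probability measures representing it, i.e. $\hat{\mathbb E}[f]=\sup_{P\in\mathcal P}E_P[f]$ for $f\in\mathcal H$; equivalently, $\mathcal P$ is the set of all Borel probability measures $P$ with $E_P[f]\le\hat{\mathbb E}[f]$ for all $f\in\mathcal H$. Write $\hat{\mathbb E}[X]=\sup_{P\in\mathcal P}E_P[X]$ also for $X\in L^1(\Omega)$, and $\hat V(A)=\sup_{P\in\mathcal P}P(A)$ for the upper capacity. Here $L^p(\Omega;\mathbb R^d)$ is the completion of the bounded Lipschitz functions $\Omega\to\mathbb R^d$ under $\|X\|_p=\hat{\mathbb E}[|X|^p]^{1/p}$ (represented by Borel functions), and $|\cdot|$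 is the Euclidean norm. Let $n\ge 1$ and let $X_1,\dots,X_n\in L^2(\Omega;\mathbb R^d)$ be independent under $\hat{\mathbb E}$, that is, for each $1\le i\le n-1$ and every bounded Lipschitz $\psi:\mathbb R^{d(i+1)}\to\mathbb R$, $$\hat{\mathbb E}[\psi(X_1,\dots,X_i,X_{i+1})]=\hat{\mathbb E}\Bigl[\hat{\mathbb E}[\psi(x_1,\dots,x_i,X_{i+1})]\big|_{(x_1,\dots,x_i)=(X_1,\dots,X_i)}\Bigr].$$ Let $M>0$ and suppose that for every $i$ one has $|X_i|\le M$ $P$-almost surely for every $P\in\mathcal P$. Put $$\Theta_i=\{\theta\in\mathbb R^d:\langle\theta,p\rangle\le\hat{\mathbb E}[\langle p,X_i\rangle]\ \text{for all }p\in\mathbb R^d\},\qquad \Theta=\Bigl\{\tfrac1n\sum_{i=1}^n\theta_i:\theta_i\in\Theta_i\Bigr\},$$ $$\rho_\Theta(x)=\inf_{\theta\in\Theta}|x-\theta|,\qquad \bar\sigma_n^2=\sup_{i\le n}\inf_{\theta\in\Theta_i}\hat{\mathbb E}\bigl[|X_i-\theta|^2\bigr].$$ Then for every $t>0$, $$\hat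 V\Bigl(\rho_\Theta\Bigl(\frac1n\sum_{i=1}^nX_i\Bigr)>t\Bigr)\le 2\cdot5^d\exp\Bigl(-\frac{nt^2}{8\bar\sigma_n^2+\frac{8Mt}{3}}\Bigr).$$ -/

import Mathlib

open MeasureTheory Filter Topology
open scoped BoundedContinuousFunction

noncomputable section

namespace SublinearExp

/-- `C_{b.Lip}(α; F)`: the vector space of bounded Lipschitz functions `α → F`. -/
def CbLip (α F : Type*) [PseudoMetricSpace α] [NormedAddCommGroup F] [NormedSpace ℝ F] :
    Submodule ℝ (α →ᵇ F) where
  carrier := {f | ∃ K, LipschitzWith K f}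
  zero_mem' := ⟨0, LipschitzWith.const 0⟩
  add_mem' := by
    rintro f g ⟨K, hK⟩ ⟨L, hL⟩
    exact ⟨K + L, hK.add hL⟩
  smul_mem' := by
    rintro c f ⟨K, hK⟩
    exact ⟨‖c‖₊ * K, (lipschitzWith_smul c).comp hK⟩

/-- The constant function `c` as an element of `C_{b.Lip}(α; ℝ)`. -/
def CbLip.const (α : Type*) [PseudoMetricSpace α] (c : ℝ) : CbLip α ℝ :=
  ⟨BoundedContinuousFunction.const α c, 0, LipschitzWith.const c⟩

/-- A regular sublinear expectation on `ℋ = C_{b.Lip}(Ω)`. -/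
structure RegularSublinearExpectation (Ω : Type*) [PseudoMetricSpace Ω] where
  /-- the functional `Ê : ℋ → ℝ` -/
  toFun : CbLip Ω ℝ → ℝ
  mono' : ∀ f g : CbLip Ω ℝ, (∀ ω, f.1 ω ≤ g.1 ω) → toFun f ≤ toFun g
  const' : ∀ c : ℝ, toFun (CbLip.const Ω c) = c
  subadd' : ∀ f g : CbLip Ω ℝ, toFun (f + g) ≤ toFun f + toFun g
  pos_homog' : ∀ (c : ℝ) (f : CbLip Ω ℝ), 0 ≤ c → toFun (c • f) = c * toFun f
  /-- regularity: `fₖ ↓ 0` pointwise implies `Ê[fₖ] ↓ 0` -/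
  regular' : ∀ f : ℕ → CbLip Ω ℝ, (∀ ω, Antitone fun k => (f k).1 ω) →
    (∀ ω, Tendsto (fun k => (f k).1 ω) atTop (𝓝 0)) →
    Tendsto (fun k => toFun (f k)) atTop (𝓝 0)

namespace RegularSublinearExpectation

variable {Ω : Type*} [MetricSpace Ω] [MeasurableSpace Ω] [BorelSpace Ω]

/-- The set `𝒫` of priors: all Borel probability measures `P` with `E_P[f] ≤ Ê[f]` for every
`f ∈ ℋ`. It is the only set that can be convex, weakly compact and represent `Ê` as
`Ê[f] = sup_{P ∈ 𝒫} E_P[f]` on `ℋ`; see `eq_priors_of_represents`. -/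
def priors (E : RegularSublinearExpectation Ω) : Set (ProbabilityMeasure Ω) :=
  {P | ∀ f : CbLip Ω ℝ, ∫ ω, f.1 ω ∂(P : Measure Ω) ≤ E.toFun f}

/-- A convex, weakly compact set of probability measures representing `Ê` is the set of priors. -/
theorem eq_priors_of_represents (E : RegularSublinearExpectation Ω)
    (Q : Set (ProbabilityMeasure Ω))
    (hconv : Convex NNReal ((fun P : ProbabilityMeasure Ω => (P : Measure Ω)) '' Q))
    (hcomp : IsCompact Q)
    (hrep : ∀ f : CbLip Ω ℝ,
      IsLUB ((fun P : ProbabilityMeasure Ω => ∫ ω, f.1 ω ∂(P : Measure Ω)) '' Q) (E.toFun f)) :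
    Q = E.priors := by
  classical
  let Φ : ProbabilityMeasure Ω → Module.Dual ℝ (CbLip Ω ℝ) := fun P =>
    { toFun := fun f => ∫ ω, f.1 ω ∂(P : Measure Ω)
      map_add' := fun f g => integral_add (f.1.integrable _) (g.1.integrable _)
      map_smul' := fun c f => integral_const_mul c _ }
  let B : Module.Dual ℝ (CbLip Ω ℝ) →ₗ[ℝ] CbLip Ω ℝ →ₗ[ℝ] ℝ := LinearMap.id
  let Ψ : ProbabilityMeasure Ω → WeakBilin B := Φ
  have hΨ : ∀ P f, B (Ψ P) f = ∫ ω, f.1 ω ∂(P : Measure Ω) := fun P f => rfl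
  have hΨc : Continuous Ψ := by
    refine WeakBilin.continuous_of_continuous_eval B fun f => ?_
    exact ProbabilityMeasure.continuous_integral_boundedContinuousFunction f.1
  have hT2 : T2Space (WeakBilin B) :=
    (WeakBilin.isEmbedding (B := B) (fun _ _ h => h)).t2Space
  have hclosed : IsClosed (Ψ '' Q) := (hcomp.image hΨc).isClosed
  have hcv : Convex ℝ (Ψ '' Q) := by
    rintro _ ⟨P, hP, rfl⟩ _ ⟨R, hR, rfl⟩ a b ha hb hab
    lift a to NNReal using ha
    lift b to NNReal using hb
    obtain ⟨S, hS, hSeq⟩ := hconv ⟨P, hP, rfl⟩ ⟨R, hR, rfl⟩ (zero_le : 0 ≤ a) (zero_le : 0 ≤ b)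
      (by exact_mod_cast hab)
    refine ⟨S, hS, ?_⟩
    refine LinearMap.ext fun f => ?_
    change ∫ ω, f.1 ω ∂(S : Measure Ω) =
      (a : ℝ) * ∫ ω, f.1 ω ∂(P : Measure Ω) + (b : ℝ) * ∫ ω, f.1 ω ∂(R : Measure Ω)
    have hSeq' : (S : Measure Ω) = a • (P : Measure Ω) + b • (R : Measure Ω) := hSeq
    rw [hSeq', integral_add_measure ((f.1.integrable _).smul_measure_nnreal)
      ((f.1.integrable _).smul_measure_nnreal), integral_smul_nnreal_measure,
      integral_smul_nnreal_measure]
    rfl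
  refine Set.Subset.antisymm (fun P hP f => (hrep f).1 ⟨P, hP, rfl⟩) fun R hR => ?_
  have hmem : Ψ R ∈ Ψ '' Q := by
    by_contra hnot
    obtain ⟨g, u, hg, hu⟩ := geometric_hahn_banach_closed_point hcv hclosed hnot
    obtain ⟨f, rfl⟩ := LinearMap.dualEmbedding_surjective B g
    have h1 : E.toFun f ≤ u := (hrep f).2 (by
      rintro _ ⟨P, hP, rfl⟩
      exact (hg _ ⟨P, hP, rfl⟩).le)
    exact absurd (hR f) (not_le.2 (h1.trans_lt hu))
  obtain ⟨P, hP, hPR⟩ := hmem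
  have hint : ∀ f : CbLip Ω ℝ,
      ∫ ω, f.1 ω ∂(P : Measure Ω) = ∫ ω, f.1 ω ∂(R : Measure Ω) := fun f =>
    LinearMap.congr_fun hPR f
  have hPR' : (P : Measure Ω) = R := by
    refine ext_of_generate_finite _
      ((BorelSpace.measurable_eq (α := Ω)).trans borel_eq_generateFrom_isClosed)
      isPiSystem_isClosed (fun F hF => ?_) (by simp)
    have hcoe : LipschitzWith 1 ((↑) : NNReal → ℝ) := LipschitzWith.subtype_val _
    have hpos : ∀ k : ℕ, (0 : ℝ) < 1 / ((k : ℝ) + 1) := fun k => by positivity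
    have hP' := tendsto_integral_thickenedIndicator_of_isClosed (P : Measure Ω) hF hpos
      tendsto_one_div_add_atTop_nhds_zero_nat
    have hR' := tendsto_integral_thickenedIndicator_of_isClosed (R : Measure Ω) hF hpos
      tendsto_one_div_add_atTop_nhds_zero_nat
    have heq : ∀ k : ℕ, ∫ ω, (thickenedIndicator (hpos k) F ω : ℝ) ∂(P : Measure Ω) =
        ∫ ω, (thickenedIndicator (hpos k) F ω : ℝ) ∂(R : Measure Ω) := fun k =>
      hint ⟨(thickenedIndicator (hpos k) F).comp _ hcoe,
        _, hcoe.comp (lipschitzWith_thickenedIndicator (hpos k) F)⟩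
    simp_rw [heq] at hP'
    exact (measureReal_eq_measureReal_iff).1 (tendsto_nhds_unique hP' hR')
  rwa [← Subtype.ext hPR']

/-- The extension of `Ê` beyond `ℋ`: the upper expectation `Ê[X] = sup_{P ∈ 𝒫} E_P[X]`. -/
def expect (E : RegularSublinearExpectation Ω) (X : Ω → ℝ) : ℝ :=
  ⨆ P : E.priors, ∫ ω, X ω ∂(P.1 : Measure Ω)

/-- The upper capacity `V̂(A) = sup_{P ∈ 𝒫} P(A)`. -/
def capacity (E : RegularSublinearExpectation Ω) (A : Set Ω) : ℝ :=
  ⨆ P : E.priors, (P.1 : Measure Ω).real A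

/-- A property holds almost surely (quasi-surely): `P`-almost surely for every prior `P`. -/
def AlmostSurely (E : RegularSublinearExpectation Ω) (p : Ω → Prop) : Prop :=
  ∀ P ∈ E.priors, ∀ᵐ ω ∂(P : Measure Ω), p ω

/-- `X ∈ L^p(Ω; F)`, the completion of the bounded Lipschitz functions under the norm
`sup_{P ∈ 𝒫} ‖·‖_{L^p(P)}`, that is `Ê[|·|^p]^{1/p}`; its elements are represented by Borel
functions that are limits of bounded Lipschitz functions in that norm. -/
def MemL (E : RegularSublinearExpectation Ω) (p : ENNReal) {F : Type*} [NormedAddCommGroup F]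
    [NormedSpace ℝ F] [MeasurableSpace F] (X : Ω → F) : Prop :=
  Measurable X ∧ ∀ ε : ENNReal, 0 < ε →
    ∃ Y : CbLip Ω F, ∀ P ∈ E.priors, eLpNorm (fun ω => X ω - Y.1 ω) p (P : Measure Ω) ≤ ε

/-- Independence of `X₁, …, Xₙ` under `Ê`: each `X_k` with a nonempty past satisfies
`Ê[ψ(X_{<k}, X_k)] = Ê[ Ê[ψ(x, X_k)] |_{x = X_{<k}} ]` for all bounded Lipschitz `ψ`. -/
def Indep (E : RegularSublinearExpectation Ω) {F : Type*} [NormedAddCommGroup F]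
    [NormedSpace ℝ F] {n : ℕ} (X : Fin n → Ω → F) : Prop :=
  ∀ k : Fin n, 0 < (k : ℕ) → ∀ ψ : CbLip ((Fin k → F) × F) ℝ,
    E.expect (fun ω => ψ.1 (fun j => X (Fin.castLE k.isLt.le j) ω, X k ω)) =
      E.expect (fun ω => E.expect fun ω' =>
        ψ.1 (fun j => X (Fin.castLE k.isLt.le j) ω, X k ω'))

variable {d : ℕ}

/-- The expectation set of `X`: the convex set with support function `g(p) = Ê[⟨p, X⟩]`. -/
def expectationSet (E : RegularSublinearExpectation Ω) (X : Ω → EuclideanSpace ℝ (Fin d)) :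
    Set (EuclideanSpace ℝ (Fin d)) :=
  {θ | ∀ p, inner ℝ θ p ≤ E.expect fun ω => inner ℝ p (X ω)}

/-- The Minkowski average `Θ = {(1/n) ∑ θᵢ : θᵢ ∈ Θᵢ}` of the expectation sets. -/
def minkowskiAverage (E : RegularSublinearExpectation Ω) {n : ℕ}
    (X : Fin n → Ω → EuclideanSpace ℝ (Fin d)) : Set (EuclideanSpace ℝ (Fin d)) :=
  {x | ∃ θ : Fin n → EuclideanSpace ℝ (Fin d),
    (∀ i, θ i ∈ E.expectationSet (X i)) ∧ x = (1 / (n : ℝ)) • ∑ i, θ i}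

/-- The variance parameter `σ̄ₙ² = sup_{i ≤ n} inf_{θ ∈ Θᵢ} Ê[|Xᵢ - θ|²]`. -/
def varianceParam (E : RegularSublinearExpectation Ω) {n : ℕ}
    (X : Fin n → Ω → EuclideanSpace ℝ (Fin d)) : ℝ :=
  ⨆ i : Fin n, ⨅ θ : E.expectationSet (X i), E.expect fun ω => ‖X i ω - θ.1‖ ^ 2

end RegularSublinearExpectation

end SublinearExp

end

/-!
The bound is proved for each prior `P` separately, with classical martingale tools.

Let `ℱ_k` be the σ-algebra generated by the `X_j` with `j < k`. Testing independence under `Ê` with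
the functions `(x, y) ↦ η(x) (φ(y) - Ê[φ(X_k)])`, `η ≥ 0`, gives `P[φ(X_k) | ℱ_k] ≤ Ê[φ(X_k)]`
almost surely under every prior (`condExp_comp_le_expect`). This has two consequences for the
conditional means `m_k = P[X_k | ℱ_k]`. With `φ` linear, `m_k ∈ Θ_k` almost surely
(`condMean_mem_expectationSet`), so that the average of the `m_k` is a random point of `Θ` and the
distance from the average of the `X_k` to `Θ` is at most the norm of the average of the
martingale differences `X_k - m_k`. With `φ(y) = |y - θ|²`, the conditional variance of `X_k` in a
unit direction is at most `Ê[|X_k - θ|²]` for every `θ ∈ Θ_k`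
(`condExp_inner_sub_condMean_sq_le`), hence at most any number above the variance parameter.

In a fixed direction `p` the differences `⟨p, X_k - m_k⟩` are bounded by `2 * M`, and Bernstein's
inequality for martingales (`measureReal_le_sum_le_exp_of_condExp`) applies. A `1 / 2`-net of the
unit ball with at most `5 ^ d` elements (`exists_finset_half_norm_le_inner`) reduces the norm to
finitely many directions, at the price of replacing `t` by `t / 2`.
-/

namespace SublinearExp

/-! ### Bernstein's inequality for martingale differences -/

/-- The inequality behind Bernstein's bound. It follows from `2 * 3 ^ k ≤ (k + 2)!`, which
dominates the tail of the exponential series by a geometric series. -/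
theorem exp_le_one_add_add_sq_div {y c : ℝ} (hy : |y| ≤ c) (hc : c < 3) :
    Real.exp y ≤ 1 + y + y ^ 2 / (2 * (1 - c / 3)) := by
  have hc0 : 0 ≤ c := (abs_nonneg y).trans hy
  have hs := NormedSpace.expSeries_div_hasSum_exp (𝔸 := ℝ) y
  rw [← Real.exp_eq_exp_ℝ] at hs
  have hs2 := (hasSum_nat_add_iff' 2).2 hs
  have hg := (hasSum_geometric_of_lt_one (r := c / 3) (by positivity) (by linarith)).mul_left
    (y ^ 2 / 2)
  have hle := hasSum_le (fun k => ?_) hs2 hg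
  · have e : y ^ 2 / 2 * (1 - c / 3)⁻¹ = y ^ 2 / (2 * (1 - c / 3)) := by
      rw [← div_eq_mul_inv, div_div]
    rw [e] at hle
    simp [Finset.sum_range_succ] at hle
    linarith
  · have hf : (2 * 3 ^ k : ℝ) ≤ ((k + 2).factorial : ℝ) := by
      have h := Nat.factorial_mul_pow_le_factorial (m := 2) (n := k)
      rw [add_comm k 2]
      exact_mod_cast h
    have h1 : y ^ (k + 2) ≤ y ^ 2 * c ^ k := by
      calc y ^ (k + 2) ≤ |y ^ (k + 2)| := le_abs_self _
        _ = y ^ 2 * |y| ^ k := by rw [pow_add, abs_mul, abs_pow, abs_pow, sq_abs, mul_comm]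
        _ ≤ _ := by gcongr
    calc y ^ (k + 2) / ((k + 2).factorial : ℝ) ≤ y ^ 2 * c ^ k / ((k + 2).factorial : ℝ) := by
          gcongr
      _ ≤ y ^ 2 * c ^ k / (2 * 3 ^ k) := by gcongr
      _ = y ^ 2 / 2 * (c / 3) ^ k := by rw [div_pow]; field_simp

section Martingale

variable {Ω : Type*} {mΩ : MeasurableSpace Ω} {μ : Measure Ω} [IsProbabilityMeasure μ]

/-- One step of the exponential supermartingale estimate. -/
theorem integral_mul_exp_le_of_condExp {m : MeasurableSpace Ω} (hm : m ≤ mΩ) {η D : Ω → ℝ}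
    {b v C l : ℝ} (hη : StronglyMeasurable[m] η) (hη0 : ∀ ω, 0 ≤ η ω) (hηC : ∀ᵐ ω ∂μ, η ω ≤ C)
    (hD : AEStronglyMeasurable[mΩ] D μ) (hDb : ∀ᵐ ω ∂μ, |D ω| ≤ b)
    (hD0 : μ[D | m] =ᵐ[μ] 0) (hDv : ∀ᵐ ω ∂μ, (μ[D ^ 2 | m]) ω ≤ v) (hl : 0 ≤ l)
    (hlb : l * b < 3) :
    ∫ ω, η ω * Real.exp (l * D ω) ∂μ ≤
      Real.exp (l ^ 2 / (2 * (1 - l * b / 3)) * v) * ∫ ω, η ω ∂μ := by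
  set c := l ^ 2 / (2 * (1 - l * b / 3)) with hc
  have hc0 : 0 ≤ c := div_nonneg (sq_nonneg _) (by linarith)
  have iη : Integrable η μ := Integrable.of_bound (hη.mono hm).aestronglyMeasurable C <| by
    filter_upwards [hηC] with ω h
    rwa [Real.norm_of_nonneg (hη0 ω)]
  have iD : Integrable D μ := Integrable.of_bound hD b hDb
  have iD2 : Integrable (D ^ 2) μ := Integrable.of_bound (hD.pow 2) (b ^ 2) <| by
    filter_upwards [hDb] with ω h
    simpa using pow_le_pow_left₀ (abs_nonneg _) h 2
  -- `g` is the quadratic majorant of `exp (l * D)`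
  set g : Ω → ℝ := (fun _ => (1 : ℝ)) + (l • D + c • D ^ 2) with hg
  have ig : Integrable g μ := (integrable_const _).add ((iD.smul l).add (iD2.smul c))
  have iηg : Integrable (η * g) μ :=
    ig.bdd_mul (c := C) (hη.mono hm).aestronglyMeasurable <| by
      filter_upwards [hηC] with ω h
      rwa [Real.norm_of_nonneg (hη0 ω)]
  have hgc : μ[g | m] ≤ᵐ[μ] fun _ => Real.exp (c * v) := by
    filter_upwards [condExp_add (m := m) (μ := μ) (integrable_const (1 : ℝ))
      ((iD.smul l).add (iD2.smul c)), condExp_add (m := m) (iD.smul l) (iD2.smul c),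
      condExp_smul (μ := μ) l D m, condExp_smul (μ := μ) c (D ^ 2) m, hD0, hDv]
      with ω h1 h2 h3 h4 h5 h6
    rw [hg, h1, Pi.add_apply, h2, Pi.add_apply, h3, h4, Pi.smul_apply, Pi.smul_apply, h5,
      condExp_const hm]
    have := Real.add_one_le_exp (c * v)
    have := mul_le_mul_of_nonneg_left h6 hc0
    simp only [smul_eq_mul, Pi.zero_apply]
    linarith
  have step : ∀ᵐ ω ∂μ, η ω * Real.exp (l * D ω) ≤ (η * g) ω := by
    filter_upwards [hDb] with ω h
    refine mul_le_mul_of_nonneg_left ?_ (hη0 ω)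
    have h' : |l * D ω| ≤ l * b := by
      rw [abs_mul, abs_of_nonneg hl]; gcongr
    refine (exp_le_one_add_add_sq_div h' hlb).trans_eq ?_
    simp only [hg, hc, Pi.add_apply, Pi.smul_apply, smul_eq_mul, Pi.pow_apply]
    ring
  calc ∫ ω, η ω * Real.exp (l * D ω) ∂μ ≤ ∫ ω, (η * g) ω ∂μ :=
        integral_mono_of_nonneg
          (ae_of_all _ fun ω => mul_nonneg (hη0 ω) (Real.exp_pos _).le) iηg step
    _ = ∫ ω, (μ[η * g | m]) ω ∂μ := (integral_condExp hm).symm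
    _ ≤ ∫ ω, Real.exp (c * v) * η ω ∂μ := by
        refine integral_mono_ae integrable_condExp (iη.const_mul _) ?_
        filter_upwards [condExp_mul_of_stronglyMeasurable_left hη iηg ig, hgc] with ω h1 h2
        rw [h1, Pi.mul_apply, mul_comm]
        exact mul_le_mul_of_nonneg_right h2 (hη0 ω)
    _ = _ := integral_const_mul _ _

variable {ℱ : Filtration ℕ mΩ} {D : ℕ → Ω → ℝ} {n : ℕ} {b v : ℝ}

theorem integral_exp_sum_le_of_condExp
    (hD : ∀ k < n, StronglyMeasurable[ℱ (k + 1)] (D k))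
    (hDb : ∀ k < n, ∀ᵐ ω ∂μ, |D k ω| ≤ b) (hD0 : ∀ k < n, μ[D k | ℱ k] =ᵐ[μ] 0)
    (hDv : ∀ k < n, ∀ᵐ ω ∂μ, (μ[D k ^ 2 | ℱ k]) ω ≤ v) {l : ℝ} (hl : 0 ≤ l) (hlb : l * b < 3) :
    ∀ m ≤ n, ∫ ω, Real.exp (l * ∑ k ∈ Finset.range m, D k ω) ∂μ ≤
      Real.exp (m * (l ^ 2 / (2 * (1 - l * b / 3)) * v)) := by
  intro m
  induction m with
  | zero => simp
  | succ m ih =>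
    intro hmn
    have hS : StronglyMeasurable[ℱ m] fun ω => ∑ k ∈ Finset.range m, D k ω := by
      refine Finset.stronglyMeasurable_fun_sum _ fun k hk => ?_
      have hk := Finset.mem_range.1 hk
      exact (hD k (by omega)).mono (ℱ.mono (by omega))
    have hSb : ∀ᵐ ω ∂μ, Real.exp (l * ∑ k ∈ Finset.range m, D k ω) ≤ Real.exp (l * (m * b)) := by
      have h : ∀ᵐ ω ∂μ, ∀ k < n, |D k ω| ≤ b := by
        rw [ae_all_iff]; intro k
        by_cases hk : k < n
        · filter_upwards [hDb k hk] with ω h _ using h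
        · exact ae_of_all _ fun ω h => absurd h hk
      filter_upwards [h] with ω h
      gcongr
      calc ∑ k ∈ Finset.range m, D k ω ≤ ∑ k ∈ Finset.range m, b :=
            Finset.sum_le_sum fun k hk =>
              (le_abs_self _).trans (h k (by have := Finset.mem_range.1 hk; omega))
        _ = m * b := by simp
    have key := integral_mul_exp_le_of_condExp (ℱ.le m)
      (Real.continuous_exp.comp_stronglyMeasurable (hS.const_mul l))
      (fun ω => (Real.exp_pos _).le) hSb
      ((hD m hmn).mono (ℱ.le _)).aestronglyMeasurable (hDb m hmn) (hD0 m hmn) (hDv m hmn) hl hlb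
    calc _ = _ := by simp_rw [Finset.sum_range_succ, mul_add, Real.exp_add]
      _ ≤ _ := key
      _ ≤ _ := mul_le_mul_of_nonneg_left (ih (by omega)) (Real.exp_pos _).le
      _ = _ := by rw [← Real.exp_add]; push_cast; ring_nf

/-- Bernstein's inequality for martingale differences with uniformly bounded conditional
variances (a form of Freedman's inequality). -/
theorem measureReal_le_sum_le_exp_of_condExp
    (hD : ∀ k < n, StronglyMeasurable[ℱ (k + 1)] (D k))
    (hDb : ∀ k < n, ∀ᵐ ω ∂μ, |D k ω| ≤ b) (hD0 : ∀ k < n, μ[D k | ℱ k] =ᵐ[μ] 0)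
    (hDv : ∀ k < n, ∀ᵐ ω ∂μ, (μ[D k ^ 2 | ℱ k]) ω ≤ v) (hb : 0 < b) (hv : 0 < v)
    {s : ℝ} (hs : 0 < s) :
    μ.real {ω | n * s ≤ ∑ k ∈ Finset.range n, D k ω} ≤
      Real.exp (-(n * s ^ 2 / (2 * v + 2 * b * s / 3))) := by
  -- this `l` turns the exponent `l ^ 2 * v / (2 * (1 - l * b / 3)) - l * s` into
  -- `-s ^ 2 / (2 * (v + b * s / 3))`
  set l := s / (v + b * s / 3) with hl
  have hq : 0 < v + b * s / 3 := by positivity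
  have hl0 : 0 ≤ l := by positivity
  have hlb : l * b < 3 := by
    rw [hl, div_mul_eq_mul_div, div_lt_iff₀ hq]; linarith
  have hmgf := integral_exp_sum_le_of_condExp hD hDb hD0 hDv hl0 hlb n le_rfl
  have hint : Integrable (fun ω => Real.exp (l * ∑ k ∈ Finset.range n, D k ω)) μ := by
    have hS : AEStronglyMeasurable (fun ω => ∑ k ∈ Finset.range n, D k ω) μ :=
      (Finset.stronglyMeasurable_fun_sum _ fun k hk =>
        (hD k (Finset.mem_range.1 hk)).mono (ℱ.le _)).aestronglyMeasurable
    refine Integrable.of_bound (Real.continuous_exp.comp_aestronglyMeasurable (hS.const_mul l))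
      (Real.exp (l * (n * b))) ?_
    have h : ∀ᵐ ω ∂μ, ∀ k < n, |D k ω| ≤ b := by
      rw [ae_all_iff]; intro k
      by_cases hk : k < n
      · filter_upwards [hDb k hk] with ω h _ using h
      · exact ae_of_all _ fun ω h => absurd h hk
    filter_upwards [h] with ω h
    rw [Real.norm_of_nonneg (Real.exp_pos _).le]
    gcongr
    calc ∑ k ∈ Finset.range n, D k ω ≤ ∑ k ∈ Finset.range n, b :=
          Finset.sum_le_sum fun k hk => (le_abs_self _).trans (h k (Finset.mem_range.1 hk))
      _ = n * b := by simp
  refine (ProbabilityTheory.measure_ge_le_exp_mul_mgf (n * s) hl0 hint).trans ?_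
  refine (mul_le_mul_of_nonneg_left hmgf (Real.exp_pos _).le).trans_eq ?_
  rw [← Real.exp_add]
  congr 1
  have h1 : 1 - l * b / 3 = v / (v + b * s / 3) := by
    rw [hl]; field_simp; ring
  rw [h1, hl]
  field_simp
  ring

end Martingale

/-! ### Nets of the unit ball -/

section Net

/-- A maximal `1 / 2`-separated subset of the unit ball is a `1 / 2`-net, with at most `5 ^ d`
elements; some element of it detects at least half of the norm of any given vector. -/
theorem exists_finset_half_norm_le_inner {F : Type*} [NormedAddCommGroup F]
    [InnerProductSpace ℝ F] [FiniteDimensional ℝ F] :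
    ∃ N : Finset F, N.card ≤ 5 ^ Module.finrank ℝ F ∧ (∀ p ∈ N, ‖p‖ ≤ 1) ∧
      ∀ x : F, ∃ p ∈ N, ‖x‖ / 2 ≤ inner ℝ p x := by
  classical
  let S : Set (Finset F) := {N | (∀ p ∈ N, ‖p‖ ≤ 1) ∧ ∀ p ∈ N, ∀ q ∈ N, p ≠ q → 1 / 2 ≤ ‖p - q‖}
  have hcard : ∀ N ∈ S, N.card ≤ 5 ^ Module.finrank ℝ F := by
    rintro N ⟨h1, h2⟩
    have hinj : Function.Injective fun x : F => (2 : ℝ) • x := smul_right_injective F two_ne_zero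
    rw [← Finset.card_image_of_injective N hinj]
    refine Besicovitch.card_le_of_separated _ ?_ ?_
    · simp only [Finset.mem_image]
      rintro _ ⟨p, hp, rfl⟩
      rw [norm_smul]
      have := h1 p hp
      norm_num
      linarith
    · simp only [Finset.mem_image]
      rintro _ ⟨p, hp, rfl⟩ _ ⟨q, hq, rfl⟩ hpq
      have := h2 p hp q hq fun h => hpq (by rw [h])
      rw [← smul_sub, norm_smul]
      norm_num
      linarith
  have hne : (Finset.card '' S).Nonempty := ⟨_, ∅, ⟨by simp, by simp⟩, rfl⟩
  have hbdd : BddAbove (Finset.card '' S) :=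
    ⟨_, by rintro _ ⟨N, hN, rfl⟩; exact hcard N hN⟩
  obtain ⟨N, hN, hNmax⟩ := Nat.sSup_mem hne hbdd
  refine ⟨N, hcard N hN, hN.1, fun x => ?_⟩
  have hnet : ∀ u : F, ‖u‖ ≤ 1 → ∃ p ∈ N, ‖p - u‖ ≤ 1 / 2 := by
    intro u hu
    by_contra! hcon
    have huN : u ∉ N := fun h => by
      have := hcon u h
      simp at this
      linarith
    have hmem : insert u N ∈ S := by
      refine ⟨?_, ?_⟩
      · intro p hp
        rcases Finset.mem_insert.1 hp with rfl | hp
        exacts [hu, hN.1 p hp]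
      · intro p hp q hq hpq
        rcases Finset.mem_insert.1 hp with rfl | hp' <;> rcases Finset.mem_insert.1 hq with rfl | hq'
        · exact absurd rfl hpq
        · rw [norm_sub_rev]; exact (hcon q hq').le
        · exact (hcon p hp').le
        · exact hN.2 p hp' q hq' hpq
    have h1 := le_csSup hbdd ⟨_, hmem, rfl⟩
    rw [Finset.card_insert_of_notMem huN, ← hNmax] at h1
    omega
  rcases eq_or_ne x 0 with rfl | hx
  · obtain ⟨p, hp, -⟩ := hnet 0 (by simp)
    exact ⟨p, hp, by simp⟩
  · have hx' : 0 < ‖x‖ := norm_pos_iff.2 hx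
    obtain ⟨p, hp, hpx⟩ := hnet (‖x‖⁻¹ • x) (by rw [norm_smul, norm_inv, norm_norm,
      inv_mul_cancel₀ hx'.ne'])
    refine ⟨p, hp, ?_⟩
    have e1 : inner ℝ (‖x‖⁻¹ • x) x = ‖x‖ := by
      rw [real_inner_smul_left, real_inner_self_eq_norm_sq]; field_simp
    have e2 : inner ℝ p x = inner ℝ (‖x‖⁻¹ • x) x + inner ℝ (p - ‖x‖⁻¹ • x) x := by
      rw [← inner_add_left]; congr 1; abel
    have e3 := abs_le.1 (abs_real_inner_le_norm (p - ‖x‖⁻¹ • x) x)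
    have e4 : ‖p - ‖x‖⁻¹ • x‖ * ‖x‖ ≤ 1 / 2 * ‖x‖ := by gcongr
    rw [e2, e1]
    linarith [e3.1]

end Net

/-! ### Conditional expectations and Lipschitz test functions -/

section CondExp

variable {Ω α : Type*} {mΩ : MeasurableSpace Ω} {μ : Measure Ω} [IsProbabilityMeasure μ]
  [PseudoMetricSpace α] [MeasurableSpace α] [BorelSpace α]

/-- Lipschitz test functions detect the sign of `∫ Z` over the events `Y ∈ C`: they approximate
the indicators of closed sets, and closed sets approximate Borel sets from inside. -/
theorem setIntegral_preimage_nonpos_of_lipschitz {Y : Ω → α} (hY : Measurable Y) {Z : Ω → ℝ}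
    (hZ : Measurable Z) {K : ℝ} (hK : ∀ ω, |Z ω| ≤ K)
    (h : ∀ (η : α → ℝ) (L : NNReal), LipschitzWith L η → (∀ x, 0 ≤ η x) → (∀ x, η x ≤ 1) →
      ∫ ω, η (Y ω) * Z ω ∂μ ≤ 0) {A : Set α} (hA : MeasurableSet A) :
    ∫ ω in Y ⁻¹' A, Z ω ∂μ ≤ 0 := by
  have iZ : Integrable Z μ := Integrable.of_bound hZ.aestronglyMeasurable K (ae_of_all _ hK)
  have hclosed : ∀ C : Set α, IsClosed C → ∫ ω in Y ⁻¹' C, Z ω ∂μ ≤ 0 := by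
    intro C hC
    have hpos : ∀ k : ℕ, (0 : ℝ) < 1 / ((k : ℝ) + 1) := fun k => by positivity
    have hcoe : LipschitzWith 1 ((↑) : NNReal → ℝ) := LipschitzWith.subtype_val _
    have hlim : Tendsto
        (fun k => ∫ ω, (thickenedIndicator (hpos k) C (Y ω) : ℝ) * Z ω ∂μ) atTop
        (𝓝 (∫ ω, (Y ⁻¹' C).indicator Z ω ∂μ)) := by
      refine tendsto_integral_of_dominated_convergence (fun _ => K) (fun k => ?_)
        (integrable_const K) (fun k => ae_of_all _ fun ω => ?_) (ae_of_all _ fun ω => ?_)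
      · refine Measurable.aestronglyMeasurable (Measurable.mul (Measurable.comp
          (g := fun x => (thickenedIndicator (hpos k) C x : ℝ)) ?_ hY) hZ)
        exact (hcoe.continuous.comp (thickenedIndicator (hpos k) C).continuous).measurable
      · rw [norm_mul, Real.norm_of_nonneg NNReal.zero_le_coe]
        have h1 : (thickenedIndicator (hpos k) C (Y ω) : ℝ) ≤ 1 := by
          exact_mod_cast thickenedIndicator_le_one (hpos k) C (Y ω)
        calc _ ≤ 1 * K := by
              gcongr
              exact hK ω
          _ = K := one_mul K
      · have h1 := thickenedIndicator_tendsto_indicator_closure hpos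
          tendsto_one_div_add_atTop_nhds_zero_nat C
        rw [hC.closure_eq, tendsto_pi_nhds] at h1
        have h2 := ((NNReal.continuous_coe.tendsto _).comp (h1 (Y ω))).mul_const (Z ω)
        have e : (Y ⁻¹' C).indicator Z ω =
            ((C.indicator (fun _ => (1 : NNReal)) (Y ω) : NNReal) : ℝ) * Z ω := by
          by_cases hω : Y ω ∈ C
          · rw [Set.indicator_of_mem hω, Set.indicator_of_mem (Set.mem_preimage.2 hω)]
            simp
          · rw [Set.indicator_of_notMem hω, Set.indicator_of_notMem (Set.mem_preimage.not.2 hω)]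
            simp
        rw [e]
        exact h2
    rw [integral_indicator (hY hC.measurableSet)] at hlim
    exact le_of_tendsto' hlim fun k => h _ _
      (hcoe.comp (lipschitzWith_thickenedIndicator (hpos k) C)) (fun x => NNReal.zero_le_coe)
      fun x => by exact_mod_cast thickenedIndicator_le_one (hpos k) C x
  have : IsProbabilityMeasure (μ.map Y) := Measure.isProbabilityMeasure_map hY.aemeasurable
  have hK0 : 0 ≤ K := by
    obtain ⟨ω⟩ := μ.nonempty_of_neZero
    exact (abs_nonneg _).trans (hK ω)
  -- a closed `C ⊆ A` with `A \ C` so small that its contribution is at most `ε`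
  refine le_of_forall_pos_le_add fun ε hε => ?_
  obtain ⟨C, hCA, hC, hlt⟩ := hA.exists_isClosed_sdiff_lt (measure_ne_top (μ.map Y) A)
    (ε := ENNReal.ofReal (ε / (K + 1))) (by simp; positivity)
  rw [Measure.map_apply hY (hA.diff hC.measurableSet)] at hlt
  have hsplit : ∫ ω in Y ⁻¹' A, Z ω ∂μ =
      ∫ ω in Y ⁻¹' C, Z ω ∂μ + ∫ ω in Y ⁻¹' (A \ C), Z ω ∂μ := by
    rw [← setIntegral_union (Disjoint.preimage _ Set.disjoint_sdiff_right)
      (hY (hA.diff hC.measurableSet)) iZ.integrableOn iZ.integrableOn, ← Set.preimage_union,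
      Set.union_sdiff_cancel hCA]
  have hsmall : ∫ ω in Y ⁻¹' (A \ C), Z ω ∂μ ≤ ε := by
    have h1 := norm_setIntegral_le_of_norm_le_const (μ := μ) (f := Z) (s := Y ⁻¹' (A \ C)) (C := K)
      (measure_lt_top _ _) fun ω _ => hK ω
    have h2 : μ.real (Y ⁻¹' (A \ C)) ≤ ε / (K + 1) :=
      ENNReal.toReal_le_of_le_ofReal (by positivity) hlt.le
    calc _ ≤ _ := le_abs_self _
      _ ≤ K * μ.real (Y ⁻¹' (A \ C)) := h1
      _ ≤ K * (ε / (K + 1)) := by gcongr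
      _ ≤ ε := by
        rw [← mul_div_assoc, div_le_iff₀ (by positivity)]
        nlinarith
  linarith [hclosed C hC]

theorem condExp_comap_nonpos_of_lipschitz {Y : Ω → α} (hY : Measurable Y) {Z : Ω → ℝ}
    (hZ : Measurable Z) {K : ℝ} (hK : ∀ ω, |Z ω| ≤ K)
    (h : ∀ (η : α → ℝ) (L : NNReal), LipschitzWith L η → (∀ x, 0 ≤ η x) → (∀ x, η x ≤ 1) →
      ∫ ω, η (Y ω) * Z ω ∂μ ≤ 0) :
    μ[Z | MeasurableSpace.comap Y inferInstance] ≤ᵐ[μ] 0 := by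
  have hm : MeasurableSpace.comap Y inferInstance ≤ mΩ := hY.comap_le
  have iZ : Integrable Z μ := Integrable.of_bound hZ.aestronglyMeasurable K (ae_of_all _ hK)
  refine ae_le_of_ae_le_trim (hm := hm) (ae_le_of_forall_setIntegral_le
    (integrable_condExp.trim hm stronglyMeasurable_condExp) (integrable_zero _ _ _) ?_)
  rintro _ ⟨A, hA, rfl⟩ -
  rw [← setIntegral_trim hm stronglyMeasurable_condExp ⟨A, hA, rfl⟩,
    setIntegral_condExp hm iZ ⟨A, hA, rfl⟩]
  simpa using setIntegral_preimage_nonpos_of_lipschitz hY hZ hK h hA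

end CondExp

/-- A bounded Lipschitz real function, as an element of `C_{b.Lip}`. -/
noncomputable def CbLip.ofBound {α : Type*} [PseudoMetricSpace α] (f : α → ℝ) {L : NNReal}
    (hf : LipschitzWith L f) {C : ℝ} (hC : ∀ x, |f x| ≤ C) : CbLip α ℝ :=
  ⟨BoundedContinuousFunction.ofNormedAddCommGroup f hf.continuous C hC, L, hf⟩

theorem lipschitzWith_mul_prod {α β : Type*} [PseudoMetricSpace α] [PseudoMetricSpace β]
    {f : α → ℝ} {g : β → ℝ} {L L' C C' : NNReal} (hf : LipschitzWith L f)
    (hfC : ∀ x, |f x| ≤ C) (hg : LipschitzWith L' g) (hgC : ∀ x, |g x| ≤ C') :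
    LipschitzWith (C * L' + C' * L) fun z : α × β => f z.1 * g z.2 := by
  refine LipschitzWith.of_dist_le_mul fun z w => ?_
  have h1 := hf.dist_le_mul z.1 w.1
  have h2 := hg.dist_le_mul z.2 w.2
  rw [Real.dist_eq] at h1 h2 ⊢
  have h3 : dist z.1 w.1 ≤ dist z w := le_max_left _ _
  have h4 : dist z.2 w.2 ≤ dist z w := le_max_right _ _
  have e : f z.1 * g z.2 - f w.1 * g w.2 = f z.1 * (g z.2 - g w.2) + g w.2 * (f z.1 - f w.1) := by
    ring
  rw [e]
  refine (abs_add_le _ _).trans ?_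
  rw [abs_mul, abs_mul]
  push_cast
  calc _ ≤ (C : ℝ) * (L' * dist z w) + C' * (L * dist z w) := by
        gcongr
        exacts [hfC _, h2.trans (by gcongr), hgC _, h1.trans (by gcongr)]
    _ = _ := by ring

/-! ### Conditional expectations under a prior -/

namespace RegularSublinearExpectation

variable {Ω : Type*} [MetricSpace Ω] [MeasurableSpace Ω]
  {E : RegularSublinearExpectation Ω}

theorem bddAbove_range_integral {f : Ω → ℝ} {C : ℝ} (hf : E.AlmostSurely fun ω => |f ω| ≤ C) :
    BddAbove (Set.range fun P : E.priors => ∫ ω, f ω ∂(P.1 : Measure Ω)) := by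
  refine ⟨C, ?_⟩
  rintro _ ⟨P, rfl⟩
  have h := norm_integral_le_of_norm_le_const (f := f) (hf P.1 P.2)
  rw [probReal_univ, mul_one] at h
  exact (le_abs_self _).trans h

theorem integral_le_expect {f : Ω → ℝ} {C : ℝ} (hf : E.AlmostSurely fun ω => |f ω| ≤ C)
    {P : ProbabilityMeasure Ω} (hP : P ∈ E.priors) :
    ∫ ω, f ω ∂(P : Measure Ω) ≤ E.expect f :=
  le_ciSup (bddAbove_range_integral hf) ⟨P, hP⟩

theorem expect_congr {f g : Ω → ℝ} (h : E.AlmostSurely fun ω => f ω = g ω) :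
    E.expect f = E.expect g :=
  iSup_congr fun P => integral_congr_ae (h P.1 P.2)

variable {F : Type*} [NormedAddCommGroup F] [NormedSpace ℝ F] [MeasurableSpace F] [BorelSpace F]
  [SecondCountableTopology F] {n : ℕ} {X : Fin n → Ω → F}

/-- Under every prior, sublinear independence bounds the conditional expectation of `φ(X_k)` given
the past by the upper expectation. The test functions are `(x, y) ↦ η(x) (φ(y) - Ê[φ(X_k)])` with
`η ≥ 0`, for which the iterated upper expectation is nonpositive. -/
theorem condExp_cbLip_le_expect (hX : ∀ i, Measurable (X i)) (hindep : E.Indep X)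
    {P : ProbabilityMeasure Ω} (hP : P ∈ E.priors) (k : Fin n) (φ : CbLip F ℝ) :
    (P : Measure Ω)[fun ω => φ.1 (X k ω) | MeasurableSpace.comap
      (fun ω (j : Fin k) => X (Fin.castLE k.isLt.le j) ω) inferInstance] ≤ᵐ[(P : Measure Ω)]
      fun _ => E.expect fun ω => φ.1 (X k ω) := by
  set c := E.expect fun ω => φ.1 (X k ω) with hc
  set Y : Ω → Fin k → F := fun ω j => X (Fin.castLE k.isLt.le j) ω with hYdef
  have hY : Measurable Y := measurable_pi_lambda _ fun j => hX _
  have hφm : Measurable fun ω => φ.1 (X k ω) := φ.1.continuous.measurable.comp (hX k)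
  have hφb : ∀ y, |φ.1 y| ≤ ‖φ.1‖ := fun y => φ.1.norm_coe_le_norm y
  have hle : ∀ Q ∈ E.priors, ∫ ω, (φ.1 (X k ω) - c) ∂(Q : Measure Ω) ≤ 0 := by
    intro Q hQ
    have h1 := integral_le_expect (f := fun ω => φ.1 (X k ω)) (C := ‖φ.1‖)
      (fun _ _ => ae_of_all _ fun ω => hφb _) hQ
    rw [integral_sub (Integrable.of_bound hφm.aestronglyMeasurable ‖φ.1‖
      (ae_of_all _ fun ω => hφb _)) (integrable_const _)]
    simpa using h1
  set K : NNReal := ‖φ.1‖₊ + ‖c‖₊ with hKdef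
  have hK : ∀ y, |φ.1 y - c| ≤ K := fun y =>
    (abs_sub _ _).trans (add_le_add_left (hφb y) _)
  have hZ : (P : Measure Ω)[fun ω => φ.1 (X k ω) - c | MeasurableSpace.comap Y inferInstance]
      ≤ᵐ[(P : Measure Ω)] 0 := by
    refine condExp_comap_nonpos_of_lipschitz hY (hφm.sub_const c) (fun ω => hK _) ?_
    intro η L hη hη0 hη1
    rcases Nat.eq_zero_or_pos (k : ℕ) with hk | hk
    · -- with an empty past, `η` is a nonnegative constant
      have : IsEmpty (Fin k) := by rw [hk]; infer_instance
      have : ∀ ω, η (Y ω) = η isEmptyElim := fun ω => congrArg η (Subsingleton.elim _ _)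
      simp_rw [this, integral_const_mul]
      exact mul_nonpos_of_nonneg_of_nonpos (hη0 _) (hle P hP)
    · obtain ⟨L', hL'⟩ := φ.2
      have hL'' : LipschitzWith L' fun y => φ.1 y - c := by
        refine LipschitzWith.of_dist_le_mul fun y z => ?_
        rw [dist_sub_right]
        exact hL'.dist_le_mul y z
      have hη1' : ∀ x, |η x| ≤ (1 : NNReal) := fun x => by
        rw [abs_of_nonneg (hη0 x)]; exact hη1 x
      have hb : ∀ z : (Fin k → F) × F, |η z.1 * (φ.1 z.2 - c)| ≤ K := fun z => by
        rw [abs_mul]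
        calc _ ≤ 1 * (K : ℝ) := mul_le_mul (hη1' _) (hK _) (abs_nonneg _) zero_le_one
          _ = K := one_mul _
      have hi := hindep k hk
        (CbLip.ofBound _ (lipschitzWith_mul_prod hη hη1' hL'' hK) hb)
      calc ∫ ω, η (Y ω) * (φ.1 (X k ω) - c) ∂(P : Measure Ω)
          ≤ E.expect fun ω => η (Y ω) * (φ.1 (X k ω) - c) :=
            integral_le_expect (C := K) (fun _ _ => ae_of_all _ fun ω => hb (Y ω, X k ω)) hP
        _ = E.expect fun ω => E.expect fun ω' => η (Y ω) * (φ.1 (X k ω') - c) := hi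
        _ ≤ 0 := by
          refine Real.iSup_le (fun Q => integral_nonpos fun ω => ?_) le_rfl
          refine Real.iSup_le (fun R => ?_) le_rfl
          rw [integral_const_mul]
          exact mul_nonpos_of_nonneg_of_nonpos (hη0 _) (hle R.1 R.2)
  have iφ : Integrable (fun ω => φ.1 (X k ω)) (P : Measure Ω) :=
    Integrable.of_bound hφm.aestronglyMeasurable ‖φ.1‖ (ae_of_all _ fun ω => hφb _)
  filter_upwards [hZ, condExp_sub iφ (integrable_const c) (MeasurableSpace.comap Y inferInstance)]
    with ω h1 h2
  have h3 := h2.symm.trans_le h1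
  rw [Pi.sub_apply, condExp_const hY.comap_le] at h3
  exact sub_nonpos.1 h3

/-- `condExp_cbLip_le_expect` for functions that are only Lipschitz on a ball carrying `X_k`: such
a function agrees on the ball with a bounded Lipschitz one. -/
theorem condExp_comp_le_expect (hX : ∀ i, Measurable (X i)) (hindep : E.Indep X)
    {P : ProbabilityMeasure Ω} (hP : P ∈ E.priors) (k : Fin n) {M : ℝ}
    (hM : E.AlmostSurely fun ω => ‖X k ω‖ ≤ M) {f : F → ℝ} {L : NNReal}
    (hf : LipschitzOnWith L f (Metric.closedBall 0 M)) {C : ℝ} (hC : ∀ x, ‖x‖ ≤ M → |f x| ≤ C) :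
    (P : Measure Ω)[fun ω => f (X k ω) | MeasurableSpace.comap
      (fun ω (j : Fin k) => X (Fin.castLE k.isLt.le j) ω) inferInstance] ≤ᵐ[(P : Measure Ω)]
      fun _ => E.expect fun ω => f (X k ω) := by
  obtain ⟨g, hg, hfg⟩ := hf.extend_real
  have hφ : LipschitzWith L fun x => max (-C) (min C (g x)) := (hg.const_min C).const_max (-C)
  have hb : ∀ x, |max (-C) (min C (g x))| ≤ |C| := fun x => by
    rcases le_total 0 C with h | h
    · rw [abs_of_nonneg h, abs_le]
      exact ⟨le_max_left _ _, max_le (by linarith) (min_le_left _ _)⟩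
    · rw [max_eq_left ((min_le_left _ _).trans (by linarith)), abs_neg]
  have heq : ∀ x, ‖x‖ ≤ M → f x = max (-C) (min C (g x)) := fun x hx => by
    have h := abs_le.1 (hC x hx)
    rw [← hfg (mem_closedBall_zero_iff.2 hx), min_eq_right h.2, max_eq_right h.1]
  have has : E.AlmostSurely fun ω => f (X k ω) = max (-C) (min C (g (X k ω))) := fun Q hQ => by
    filter_upwards [hM Q hQ] with ω h using heq _ h
  have key := condExp_cbLip_le_expect hX hindep hP k (CbLip.ofBound _ hφ hb)
  rw [expect_congr has]
  exact (condExp_congr_ae (has P hP)).le.trans key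

end RegularSublinearExpectation

/-! ### Conditional means and the expectation sets -/

/-- The filtration of strict pasts: its `k`-th σ-algebra is generated by the `X_j` with `j < k`. -/
def pastFiltration {Ω F : Type*} [mΩ : MeasurableSpace Ω] [MeasurableSpace F] {n : ℕ}
    {X : Fin n → Ω → F} (hX : ∀ i, Measurable (X i)) : Filtration ℕ mΩ where
  seq k := ⨆ (j : Fin n) (_ : (j : ℕ) < k), MeasurableSpace.comap (X j) inferInstance
  mono' := fun _ _ hkl => iSup_mono fun _ => iSup_mono' fun hj => ⟨hj.trans_le hkl, le_rfl⟩
  le' := fun _ => iSup₂_le fun j _ => (hX j).comap_le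

theorem pastFiltration_eq_comap {Ω F : Type*} [mΩ : MeasurableSpace Ω] [MeasurableSpace F] {n : ℕ}
    {X : Fin n → Ω → F} (hX : ∀ i, Measurable (X i)) (k : Fin n) :
    pastFiltration hX k = MeasurableSpace.comap
      (fun ω (j : Fin k) => X (Fin.castLE k.isLt.le j) ω) inferInstance := by
  have h : MeasurableSpace.comap (fun ω (j : Fin k) => X (Fin.castLE k.isLt.le j) ω)
      inferInstance = ⨆ j : Fin k, MeasurableSpace.comap (X (Fin.castLE k.isLt.le j))
        inferInstance := by
    change MeasurableSpace.comap _ (⨆ _, _) = _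
    rw [MeasurableSpace.comap_iSup]
    simp_rw [MeasurableSpace.comap_comp]
    rfl
  rw [h]
  refine le_antisymm (iSup₂_le fun j hj => ?_) (iSup_le fun j => ?_)
  · exact le_iSup (fun i : Fin k => MeasurableSpace.comap (X (Fin.castLE k.isLt.le i))
      inferInstance) ⟨j, hj⟩
  · exact le_iSup₂ (f := fun (i : Fin n) (_ : (i : ℕ) < k) =>
      MeasurableSpace.comap (X i) inferInstance) (Fin.castLE k.isLt.le j) j.2

theorem stronglyMeasurable_pastFiltration {Ω F : Type*} [MeasurableSpace Ω]
    [NormedAddCommGroup F] [MeasurableSpace F] [BorelSpace F] [SecondCountableTopology F] {n : ℕ}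
    {X : Fin n → Ω → F} (hX : ∀ i, Measurable (X i)) (j : Fin n) {k : ℕ} (hj : (j : ℕ) < k) :
    StronglyMeasurable[pastFiltration hX k] (X j) := by
  have h : MeasurableSpace.comap (X j) inferInstance ≤ pastFiltration hX k :=
    le_iSup₂ (f := fun (i : Fin n) (_ : (i : ℕ) < k) =>
      MeasurableSpace.comap (X i) inferInstance) j hj
  exact ((comap_measurable (X j)).mono h le_rfl).stronglyMeasurable

namespace RegularSublinearExpectation

variable {Ω : Type*} [MetricSpace Ω] [MeasurableSpace Ω]
  {E : RegularSublinearExpectation Ω} {d n : ℕ} {X : Fin n → Ω → EuclideanSpace ℝ (Fin d)}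
  {P : ProbabilityMeasure Ω} {M : ℝ}

theorem lipschitzWith_expect_inner {Y : Ω → EuclideanSpace ℝ (Fin d)} (hY : Measurable Y)
    (hM0 : 0 ≤ M) (hM : E.AlmostSurely fun ω => ‖Y ω‖ ≤ M) (hP : P ∈ E.priors) :
    LipschitzWith ⟨M, hM0⟩ fun p => E.expect fun ω => inner ℝ p (Y ω) := by
  have hb : ∀ p, E.AlmostSurely fun ω => |inner ℝ p (Y ω)| ≤ ‖p‖ * M := fun p Q hQ => by
    filter_upwards [hM Q hQ] with ω h
    exact (abs_real_inner_le_norm _ _).trans (by gcongr)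
  refine LipschitzWith.of_le_add_mul _ fun p q => ?_
  have : Nonempty E.priors := ⟨⟨P, hP⟩⟩
  refine ciSup_le fun Q => ?_
  have hi : ∀ p, Integrable (fun ω => inner ℝ p (Y ω)) (Q.1 : Measure Ω) := fun p =>
    Integrable.of_bound (hY.const_inner).aestronglyMeasurable _ (hb p Q.1 Q.2)
  calc ∫ ω, inner ℝ p (Y ω) ∂(Q.1 : Measure Ω)
      ≤ ∫ ω, (inner ℝ q (Y ω) + M * dist p q) ∂(Q.1 : Measure Ω) := by
        refine integral_mono_ae (hi p) ((hi q).add (integrable_const _)) ?_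
        filter_upwards [hM Q.1 Q.2] with ω h
        have h1 : inner ℝ p (Y ω) = inner ℝ q (Y ω) + inner ℝ (p - q) (Y ω) := by
          rw [← inner_add_left]; congr 1; abel
        have h2 : inner ℝ (p - q) (Y ω) ≤ ‖p - q‖ * M :=
          (real_inner_le_norm _ _).trans (by gcongr)
        rw [dist_eq_norm]
        linarith
    _ = ∫ ω, inner ℝ q (Y ω) ∂(Q.1 : Measure Ω) + M * dist p q := by
        rw [integral_add (hi q) (integrable_const _)]
        simp
    _ ≤ _ := add_le_add_left (integral_le_expect (hb q) Q.2) _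

/-- The conditional mean of `X_k` given the past under `P`. -/
noncomputable def condMean (hX : ∀ i, Measurable (X i)) (P : ProbabilityMeasure Ω) (k : Fin n) :
    Ω → EuclideanSpace ℝ (Fin d) :=
  (P : Measure Ω)[X k | pastFiltration hX k]

theorem integrable_of_almostSurely (hX : ∀ i, Measurable (X i))
    (hM : ∀ i, E.AlmostSurely fun ω => ‖X i ω‖ ≤ M) (hP : P ∈ E.priors) (k : Fin n) :
    Integrable (X k) (P : Measure Ω) :=
  Integrable.of_bound (hX k).aestronglyMeasurable M (hM k P hP)

theorem norm_condMean_le (hX : ∀ i, Measurable (X i))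
    (hM : ∀ i, E.AlmostSurely fun ω => ‖X i ω‖ ≤ M) (hP : P ∈ E.priors) (k : Fin n) :
    ∀ᵐ ω ∂(P : Measure Ω), ‖condMean hX P k ω‖ ≤ M := by
  have h := Convex.condExp_mem ((pastFiltration hX).le k) (integrable_of_almostSurely hX hM hP k)
    Metric.isClosed_closedBall (convex_closedBall (0 : EuclideanSpace ℝ (Fin d)) M)
    (by simpa using hM k P hP)
  simpa [condMean] using h

theorem condExp_inner_eq (hX : ∀ i, Measurable (X i))
    (hM : ∀ i, E.AlmostSurely fun ω => ‖X i ω‖ ≤ M) (hP : P ∈ E.priors) (k : Fin n)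
    (p : EuclideanSpace ℝ (Fin d)) :
    (P : Measure Ω)[fun ω => inner ℝ p (X k ω) | pastFiltration hX k] =ᵐ[(P : Measure Ω)]
      fun ω => inner ℝ p (condMean hX P k ω) := by
  have h := (innerSL ℝ p).comp_condExp_comm (m := pastFiltration hX k)
    (integrable_of_almostSurely hX hM hP k)
  exact h.symm

/-- Almost surely, the conditional means lie in the expectation sets: the inequalities defining
`Θ_k` hold simultaneously on a countable dense set of directions, hence everywhere. -/
theorem condMean_mem_expectationSet (hX : ∀ i, Measurable (X i)) (hindep : E.Indep X)
    (hM0 : 0 ≤ M) (hM : ∀ i, E.AlmostSurely fun ω => ‖X i ω‖ ≤ M) (hP : P ∈ E.priors)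
    (k : Fin n) :
    ∀ᵐ ω ∂(P : Measure Ω), condMean hX P k ω ∈ E.expectationSet (X k) := by
  have hdir : ∀ p, ∀ᵐ ω ∂(P : Measure Ω),
      inner ℝ (condMean hX P k ω) p ≤ E.expect fun ω => inner ℝ p (X k ω) := by
    intro p
    have h := condExp_comp_le_expect hX hindep hP k (hM k)
      (f := fun x => inner ℝ p x) ((innerSL ℝ p).lipschitz.lipschitzOnWith) (C := ‖p‖ * M)
      fun x hx => (abs_real_inner_le_norm _ _).trans (by gcongr)
    rw [← pastFiltration_eq_comap hX k] at h
    filter_upwards [h, condExp_inner_eq hX hM hP k p] with ω h1 h2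
    rw [real_inner_comm, ← h2]
    exact h1
  have hall := ae_all_iff.2 fun i : ℕ =>
    hdir (TopologicalSpace.denseSeq (EuclideanSpace ℝ (Fin d)) i)
  filter_upwards [hall] with ω h
  have hclosed : IsClosed {p | inner ℝ (condMean hX P k ω) p ≤
      E.expect fun ω => inner ℝ p (X k ω)} :=
    isClosed_le (by fun_prop) (lipschitzWith_expect_inner (hX k) hM0 (hM k) hP).continuous
  have hsub := hclosed.closure_subset_iff.2 (Set.range_subset_iff.2 h)
  rw [(TopologicalSpace.denseRange_denseSeq _).closure_range] at hsub
  exact fun p => hsub (Set.mem_univ p)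

/-- The conditional variance of `⟨p, X_k⟩` is at most `Ê[|X_k - θ|²]` for every `θ`, because the
conditional mean is the best predictor. -/
theorem condExp_inner_sub_condMean_sq_le (hX : ∀ i, Measurable (X i)) (hindep : E.Indep X)
    (hM0 : 0 ≤ M) (hM : ∀ i, E.AlmostSurely fun ω => ‖X i ω‖ ≤ M) (hP : P ∈ E.priors)
    (k : Fin n) {p : EuclideanSpace ℝ (Fin d)} (hp : ‖p‖ ≤ 1) (θ : EuclideanSpace ℝ (Fin d)) :
    ∀ᵐ ω ∂(P : Measure Ω),
      ((P : Measure Ω)[fun ω => inner ℝ p (X k ω - condMean hX P k ω) ^ 2 |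
        pastFiltration hX k]) ω ≤ E.expect fun ω => ‖X k ω - θ‖ ^ 2 := by
  have hm := (pastFiltration hX).le k
  set Z : Ω → ℝ := fun ω => inner ℝ p (X k ω) - inner ℝ p θ with hZ
  have hZm : Measurable Z := ((hX k).const_inner).sub_const _
  have hZle : ∀ ω, Z ω ^ 2 ≤ ‖X k ω - θ‖ ^ 2 := fun ω => by
    rw [← sq_abs, hZ]
    simp only
    rw [← inner_sub_right]
    refine pow_le_pow_left₀ (abs_nonneg _) ((abs_real_inner_le_norm _ _).trans ?_) 2
    exact mul_le_of_le_one_left (norm_nonneg _) hp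
  have hXb : ∀ᵐ ω ∂(P : Measure Ω), ‖‖X k ω - θ‖ ^ 2‖ ≤ (M + ‖θ‖) ^ 2 := by
    filter_upwards [hM k P hP] with ω h
    rw [Real.norm_of_nonneg (by positivity)]
    exact pow_le_pow_left₀ (norm_nonneg _) ((norm_sub_le _ _).trans (by gcongr)) 2
  have hXi : Integrable (fun ω => ‖X k ω - θ‖ ^ 2) (P : Measure Ω) :=
    Integrable.of_bound (((hX k).sub_const θ).norm.pow_const 2).aestronglyMeasurable _ hXb
  have hZ2i : Integrable (Z ^ 2) (P : Measure Ω) :=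
    hXi.mono' (hZm.pow_const 2).aestronglyMeasurable (ae_of_all _ fun ω => by
      rw [Pi.pow_apply, Real.norm_of_nonneg (sq_nonneg _)]; exact hZle ω)
  have hZ2 : MemLp Z 2 (P : Measure Ω) :=
    (memLp_two_iff_integrable_sq hZm.aestronglyMeasurable).2 hZ2i
  have hcond : (P : Measure Ω)[Z | pastFiltration hX k] =ᵐ[(P : Measure Ω)]
      fun ω => inner ℝ p (condMean hX P k ω) - inner ℝ p θ := by
    have hi : Integrable (fun ω => inner ℝ p (X k ω)) (P : Measure Ω) :=
      (integrable_of_almostSurely hX hM hP k).const_inner p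
    filter_upwards [condExp_sub hi (integrable_const (inner ℝ p θ)) (pastFiltration hX k),
      condExp_inner_eq hX hM hP k p] with ω h1 h2
    refine h1.trans ?_
    rw [Pi.sub_apply, h2, condExp_const hm]
  have hD : (fun ω => inner ℝ p (X k ω - condMean hX P k ω) ^ 2) =ᵐ[(P : Measure Ω)]
      (Z - (P : Measure Ω)[Z | pastFiltration hX k]) ^ 2 := by
    filter_upwards [hcond] with ω h
    rw [Pi.pow_apply, Pi.sub_apply, h, hZ, inner_sub_right]
    ring
  have hL : LipschitzOnWith ⟨2 * (M + ‖θ‖), by positivity⟩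
      (fun x : EuclideanSpace ℝ (Fin d) => ‖x - θ‖ ^ 2) (Metric.closedBall 0 M) := by
    refine LipschitzOnWith.of_dist_le_mul fun x hx y hy => ?_
    rw [mem_closedBall_zero_iff] at hx hy
    have h1 : ‖x - θ‖ ≤ M + ‖θ‖ := (norm_sub_le _ _).trans (by gcongr)
    have h2 : ‖y - θ‖ ≤ M + ‖θ‖ := (norm_sub_le _ _).trans (by gcongr)
    have h3 : |‖x - θ‖ - ‖y - θ‖| ≤ dist x y := by
      rw [dist_eq_norm, ← sub_sub_sub_cancel_right x y θ]
      exact abs_norm_sub_norm_le _ _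
    rw [Real.dist_eq, sq_sub_sq, abs_mul, abs_of_nonneg (by positivity)]
    change _ ≤ 2 * (M + ‖θ‖) * dist x y
    gcongr
    linarith
  have hE := condExp_comp_le_expect hX hindep hP k (hM k) hL (C := (M + ‖θ‖) ^ 2) fun x hx => by
    rw [abs_of_nonneg (by positivity)]
    exact pow_le_pow_left₀ (norm_nonneg _) ((norm_sub_le _ _).trans (by gcongr)) 2
  rw [← pastFiltration_eq_comap hX k] at hE
  filter_upwards [condExp_congr_ae (m := pastFiltration hX k) hD,
    ProbabilityTheory.condVar_ae_le_condExp_sq hm hZ2,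
    condExp_mono (m := pastFiltration hX k) hZ2i hXi (ae_of_all _ hZle), hE] with ω h1 h2 h3 h4
  rw [h1]
  exact (h2.trans h3).trans h4

/-- Bernstein's inequality for the centred sums in a fixed direction, under a fixed prior. -/
theorem measureReal_le_sum_inner_sub_condMean (hX : ∀ i, Measurable (X i)) (hindep : E.Indep X)
    (hM0 : 0 < M) (hM : ∀ i, E.AlmostSurely fun ω => ‖X i ω‖ ≤ M) (hP : P ∈ E.priors)
    {p : EuclideanSpace ℝ (Fin d)} (hp : ‖p‖ ≤ 1) {v : ℝ} (hv : E.varianceParam X < v)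
    {s : ℝ} (hs : 0 < s) :
    (P : Measure Ω).real {ω | n * s ≤ ∑ i, inner ℝ p (X i ω - condMean hX P i ω)} ≤
      Real.exp (-(n * s ^ 2 / (2 * v + 2 * (2 * M) * s / 3))) := by
  have hv0 : 0 < v := by
    refine lt_of_le_of_lt ?_ hv
    exact Real.iSup_nonneg fun i => Real.iInf_nonneg fun θ =>
      Real.iSup_nonneg fun Q => integral_nonneg fun ω => by positivity
  set ℱ := pastFiltration hX
  -- the increments, extended by zero beyond `n` to be indexed by `ℕ`
  set D : ℕ → Ω → ℝ := fun k ω =>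
    if h : k < n then inner ℝ p (X ⟨k, h⟩ ω - condMean hX P ⟨k, h⟩ ω) else 0 with hDdef
  have hDk : ∀ k (h : k < n),
      D k = fun ω => inner ℝ p (X ⟨k, h⟩ ω - condMean hX P ⟨k, h⟩ ω) := fun k h => by
    funext ω; simp [hDdef, h]
  have hsum : ∀ ω, ∑ i, inner ℝ p (X i ω - condMean hX P i ω) = ∑ k ∈ Finset.range n, D k ω := by
    intro ω
    rw [Finset.sum_range]
    exact Finset.sum_congr rfl fun i _ => by rw [hDk i i.isLt]
  simp_rw [hsum]
  refine measureReal_le_sum_le_exp_of_condExp (ℱ := ℱ) (b := 2 * M) ?_ ?_ ?_ ?_ (by positivity)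
    hv0 hs
  · intro k h
    rw [hDk k h]
    have h1 : StronglyMeasurable[ℱ (k + 1)] (X ⟨k, h⟩) :=
      stronglyMeasurable_pastFiltration hX ⟨k, h⟩ (Nat.lt_succ_self k)
    have h2 : StronglyMeasurable[ℱ (k + 1)] (condMean hX P ⟨k, h⟩) :=
      StronglyMeasurable.mono (stronglyMeasurable_condExp (m := ℱ k)) (ℱ.mono (Nat.le_succ k))
    exact (innerSL ℝ p).continuous.comp_stronglyMeasurable (h1.sub h2)
  · intro k h
    rw [hDk k h]
    filter_upwards [hM ⟨k, h⟩ P hP, norm_condMean_le hX hM hP ⟨k, h⟩] with ω h1 h2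
    refine (abs_real_inner_le_norm _ _).trans ?_
    calc _ ≤ 1 * (‖X ⟨k, h⟩ ω‖ + ‖condMean hX P ⟨k, h⟩ ω‖) := by
          gcongr
          exact norm_sub_le _ _
      _ ≤ 2 * M := by linarith
  · intro k h
    rw [hDk k h]
    have hi := integrable_of_almostSurely hX hM hP ⟨k, h⟩
    have hic : Integrable (condMean hX P ⟨k, h⟩) (P : Measure Ω) := integrable_condExp
    have hcomm := (innerSL ℝ p).comp_condExp_comm (m := ℱ k) (hi.sub hic)
    filter_upwards [hcomm, condExp_sub hi hic (ℱ k),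
      (condExp_condExp_of_le (f := X ⟨k, h⟩) (μ := (P : Measure Ω)) (le_refl (ℱ k)) (ℱ.le k))]
      with ω h1 h2 h3
    refine h1.symm.trans ?_
    have h4 : ((P : Measure Ω)[condMean hX P ⟨k, h⟩ | ℱ k]) ω =
        ((P : Measure Ω)[X ⟨k, h⟩ | ℱ k]) ω := h3
    rw [Function.comp_apply, h2, Pi.sub_apply, h4, sub_self, map_zero, Pi.zero_apply]
  · intro k h
    obtain ⟨ω₀, hω₀⟩ :=
      (condMean_mem_expectationSet hX hindep hM0.le hM hP ⟨k, h⟩).exists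
    have : Nonempty (E.expectationSet (X ⟨k, h⟩)) := ⟨⟨_, hω₀⟩⟩
    have hlt : ⨅ θ : E.expectationSet (X ⟨k, h⟩), E.expect (fun ω => ‖X ⟨k, h⟩ ω - θ.1‖ ^ 2) < v :=
      (le_ciSup (f := fun i : Fin n => ⨅ θ : E.expectationSet (X i),
        E.expect fun ω => ‖X i ω - θ.1‖ ^ 2) (Set.finite_range _).bddAbove ⟨k, h⟩).trans_lt hv
    obtain ⟨θ, hθ⟩ := exists_lt_of_ciInf_lt hlt
    filter_upwards [condExp_inner_sub_condMean_sq_le hX hindep hM0.le hM hP ⟨k, h⟩ hp θ.1]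
      with ω h1
    rw [hDk k h]
    exact h1.trans hθ.le

end RegularSublinearExpectation

end SublinearExp

/-! ### The concentration inequality -/

open SublinearExp RegularSublinearExpectation in
theorem mainTheorem1 {Ω : Type*} [MetricSpace Ω] [CompleteSpace Ω]
    [TopologicalSpace.SeparableSpace Ω] [MeasurableSpace Ω] [BorelSpace Ω]
    (E : SublinearExp.RegularSublinearExpectation Ω) {d n : ℕ} (hn : 0 < n)
    (X : Fin n → Ω → EuclideanSpace ℝ (Fin d)) (M : ℝ) (hM : 0 < M)
    (hL2 : ∀ i, E.MemL 2 (X i))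
    (hbdd : ∀ i, E.AlmostSurely fun ω => ‖X i ω‖ ≤ M)
    (hindep : E.Indep X) (t : ℝ) (ht : 0 < t) :
    E.capacity {ω | t < Metric.infDist ((1 / (n : ℝ)) • ∑ i, X i ω) (E.minkowskiAverage X)} ≤
      2 * 5 ^ d * Real.exp (-(n * t ^ 2 / (8 * E.varianceParam X + 8 * M * t / 3))) := by
  have hX : ∀ i, Measurable (X i) := fun i => (hL2 i).1
  have hn' : (0 : ℝ) < n := by exact_mod_cast hn
  refine Real.iSup_le (fun ⟨P, hP⟩ => ?_) (by positivity)
  obtain ⟨N, hNcard, hN1, hN⟩ := exists_finset_half_norm_le_inner (F := EuclideanSpace ℝ (Fin d))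
  rw [finrank_euclideanSpace_fin] at hNcard
  let A : EuclideanSpace ℝ (Fin d) → Set Ω := fun p =>
    {ω | n * (t / 2) ≤ ∑ i, inner ℝ p (X i ω - condMean hX P i ω)}
  have hsub : {ω | t < Metric.infDist ((1 / (n : ℝ)) • ∑ i, X i ω) (E.minkowskiAverage X)}
      ≤ᵐ[(P : Measure Ω)] ⋃ p ∈ N, A p := by
    filter_upwards [ae_all_iff.2 fun i =>
      condMean_mem_expectationSet hX hindep hM.le hbdd hP i] with ω hω h
    have hmem : (1 / (n : ℝ)) • ∑ i, condMean hX P i ω ∈ E.minkowskiAverage X := ⟨_, hω, rfl⟩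
    have h1 : t < ‖(1 / (n : ℝ)) • ∑ i, (X i ω - condMean hX P i ω)‖ := by
      refine lt_of_lt_of_le h ((Metric.infDist_le_dist_of_mem hmem).trans_eq ?_)
      rw [dist_eq_norm, ← smul_sub, Finset.sum_sub_distrib]
    obtain ⟨p, hp, hpx⟩ := hN ((1 / (n : ℝ)) • ∑ i, (X i ω - condMean hX P i ω))
    refine Set.mem_biUnion hp ?_
    rw [inner_smul_right, inner_sum, one_div, inv_mul_eq_div, le_div_iff₀ hn'] at hpx
    rw [one_div] at h1
    change n * (t / 2) ≤ _
    nlinarith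
  have hle : ∀ v, E.varianceParam X < v →
      (P : Measure Ω).real
        {ω | t < Metric.infDist ((1 / (n : ℝ)) • ∑ i, X i ω) (E.minkowskiAverage X)} ≤
      5 ^ d * Real.exp (-(n * t ^ 2 / (8 * v + 8 * M * t / 3))) := by
    intro v hv
    calc _ ≤ (P : Measure Ω).real (⋃ p ∈ N, A p) :=
          ENNReal.toReal_mono (measure_ne_top _ _) (measure_mono_ae hsub)
      _ ≤ ∑ p ∈ N, (P : Measure Ω).real (A p) := measureReal_biUnion_finset_le _ _
      _ ≤ ∑ p ∈ N, Real.exp (-(n * (t / 2) ^ 2 / (2 * v + 2 * (2 * M) * (t / 2) / 3))) :=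
          Finset.sum_le_sum fun p hp => measureReal_le_sum_inner_sub_condMean hX hindep hM hbdd hP
            (hN1 p hp) hv (half_pos ht)
      _ = N.card * Real.exp (-(n * t ^ 2 / (8 * v + 8 * M * t / 3))) := by
          rw [Finset.sum_const, nsmul_eq_mul]
          congr 3
          rw [← mul_div_mul_left _ (2 * v + _) (four_ne_zero' ℝ)]
          congr 1 <;> ring
      _ ≤ _ := by
          gcongr
          exact_mod_cast hNcard
  have hσ : 0 ≤ E.varianceParam X :=
    Real.iSup_nonneg fun i => Real.iInf_nonneg fun θ =>
      Real.iSup_nonneg fun Q => integral_nonneg fun ω => by positivity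
  -- the variance parameter may vanish or not be attained, so it is approached from above
  have hcont : ContinuousAt
      (fun v : ℝ => 5 ^ d * Real.exp (-(n * t ^ 2 / (8 * v + 8 * M * t / 3))))
      (E.varianceParam X) := by
    have hne : 8 * E.varianceParam X + 8 * M * t / 3 ≠ 0 := by positivity
    fun_prop (disch := exact hne)
  have hlim := ge_of_tendsto (hcont.tendsto.mono_left nhdsWithin_le_nhds)
    (eventually_nhdsWithin_of_forall (s := Set.Ioi (E.varianceParam X)) hle)
  refine hlim.trans ?_
  gcongr
  exact le_mul_of_one_le_left (by positivity) one_le_two
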